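/- We work over $\mathbb{C}$; varieties are reduced separated schemes of finite type over $\mathbb{C}$, identified with their sets of complex points. An ind-variety is a set $\mathcal V$ with a filtration $V_1\hookrightarrow V_2\hookrightarrow\cdots$ by varieties and closed embeddings such that $\mathcal V=\bigcup_i V_i$; a subset is open if its trace on every $V_i$ is open. A morphism $\mathcal V\to\mathcal V'$ of ind-varieties is a map $\varphi$ such that for every $i$ there is a $j$ with $\varphi(V_i)\subset V'_j$ and $\varphi|_{V_i}\colon V_i\to V'_j$ a morphism of varieties. Two filtrations of $\mathcal V$ are equivalent if the identity is an isomorphism between the resulting ind-varieties. An ind-torus is an ind-group isomorphic to $(\mathbb{C}^*)^k$ for some $k\ge 0$ or to $(\mathbb{C}^*)^\infty=\varinjlim_k(\mathbb{C}^*)^k$ (embeddings $a\mapsto(a,1)$). A toric variety is an irreducible (not necessarily normal) variety containing an algebraic torus as an open subset such that the action of the torus on itself by translations extends to a regular action on the variety; a morphism of toric varieties is toric if it restricts to a morphism of algebraic groups between the acting tori. A toric ind-variety is an ind-variety $\mathcal V$ that is curve-connected (any two points lie in the image of a morphism $C\to\mathcal V$ from an irreducible algebraic curve $C$) and contains an ind-torus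 $\mathcal T_{\mathcal V}$ as an open subset such that the action of $\mathcal T_{\mathcal V}$ on itself by translations extends to a regular action on $\mathcal V$. A morphism $\alpha\colon\mathcal V\to\mathcal V'$ of ind-varieties between toric ind-varieties is toric if $\alpha(\mathcal T_{\mathcal V})\subset\mathcal T_{\mathcal V'}$ and $\alpha|_{\mathcal T_{\mathcal V}}\colon\mathcal T_{\mathcal V}\to\mathcal T_{\mathcal V'}$ is a morphism of ind-groups. A toric filtration of $\mathcal V$ is a filtration $V_1\hookrightarrow V_2\hookrightarrow\cdots$ of $\mathcal V$, equivalent to the given one, such that each $V_i$ is a toric variety with acting torus $T_i$, each closed embedding $V_i\hookrightarrow V_{i+1}$ is a toric morphism, and $\mathcal T_{\mathcal V}=\varinjlim T_i$ as an ind-group. Proposition. Let $\alpha\colon\mathcal V\to\mathcal V'$ be a morphism of ind-varieties between toric ind-varieties $\mathcal V$ and $\mathcal V'$. Then $\alpha$ is toric if and only if for all toric filtrations $V_1\hookrightarrow V_2\hookrightarrow\cdots$ of $\mathcal V$ and $V'_1\hookrightarrow V'_2\hookrightarrow\cdots$ of $\mathcal V'$ and for every $i>0$ there exists $j>0$ such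 that $\alpha(V_i)\subset V'_j$ and $\alpha|_{V_i}\colon V_i\to V'_j$ is a toric morphism of toric varieties. -/

import Mathlib

open CategoryTheory AlgebraicGeometry MonoidalCategory CartesianMonoidalCategory

universe u v w

noncomputable section

namespace ToricInd

/-! ## Complex algebraic varieties -/

/-- The base scheme `Spec ℂ`. -/
abbrev SpecC : Scheme.{0} := Spec (.of ℂ)

/-- The set `X(ℂ)` of (closed, i.e. complex) points of a scheme `X` over `ℂ`. -/
abbrev Pt (X : Over SpecC) : Type := Over.mk (𝟙 SpecC) ⟶ X

/-- Complex algebraic varieties: reduced separated schemes of finite type over `ℂ`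
(not necessarily irreducible). Morphisms of varieties are morphisms of schemes over `ℂ`. -/
class IsVariety (X : Over SpecC) : Prop where
  isReduced : IsReduced X.left
  isSeparated : IsSeparated X.hom
  locallyOfFiniteType : LocallyOfFiniteType X.hom
  quasiCompact : QuasiCompact X.hom

/-- Irreducible algebraic curves. -/
structure IsIrreducibleCurve (C : Over SpecC) : Prop where
  isVariety : IsVariety C
  irreducible : IrreducibleSpace C.left
  dim_eq_one : topologicalKrullDim C.left = 1

/-! ## Ind-varieties -/

/-- A structure of ind-variety on the set `𝒱`: a sequence of closed embeddings of varieties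
`V 0 ↪ V 1 ↪ ⋯` together with an identification of `𝒱` with the union of the sets of points
of the `V i`. -/
structure IndVariety (𝒱 : Type u) where
  V : ℕ → Over SpecC
  isVariety : ∀ i, IsVariety (V i)
  φ : ∀ i, V i ⟶ V (i + 1)
  isClosedImmersion : ∀ i, IsClosedImmersion (φ i).left
  /-- the inclusion of (the set of points of) the stratum `V i` into `𝒱` -/
  ι : ∀ i, Pt (V i) → 𝒱
  ι_injective : ∀ i, Function.Injective (ι i)
  ι_comp : ∀ i p, ι (i + 1) (p ≫ φ i) = ι i p
  exists_ι_eq : ∀ x, ∃ i p, ι i p = x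

namespace IndVariety

variable {𝒱 : Type u} {𝒲 : Type v}

/-- `f : 𝒱 → 𝒲` is a morphism of ind-varieties: for every `i` there is a `j` such that `f`
maps the stratum `V i` into the stratum `W j` and restricts to a morphism of varieties
`V i ⟶ W j`. -/
def IsMorphism (S : IndVariety 𝒱) (R : IndVariety 𝒲) (f : 𝒱 → 𝒲) : Prop :=
  ∀ i, ∃ j, ∃ g : S.V i ⟶ R.V j, ∀ p, R.ι j (p ≫ g) = f (S.ι i p)

/-- A bijection that is, together with its inverse, a morphism of ind-varieties. -/
def IsIsomorphism (S : IndVariety 𝒱) (R : IndVariety 𝒲) (e : 𝒱 ≃ 𝒲) : Prop :=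
  S.IsMorphism R e ∧ R.IsMorphism S e.symm

/-- Two filtrations on the same set are equivalent if the identity is an isomorphism. -/
def Equivalent (S R : IndVariety 𝒱) : Prop :=
  S.IsIsomorphism R (Equiv.refl 𝒱)

/-- `e : U → 𝒱` is an open embedding of ind-varieties: `e` identifies the ind-variety `U` with an
open subset of `𝒱` (that is, a subset whose trace on every stratum `V i` is open), endowed with
the filtration by the open subvarieties `e(U) ∩ V i`, up to equivalence of filtrations. -/
def IsOpenEmbedding {U : Type w} (R : IndVariety U) (S : IndVariety 𝒱) (e : U → 𝒱) : Prop :=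
  Function.Injective e ∧
    ∃ R' : IndVariety U, R.Equivalent R' ∧
      ∀ i, ∃ u : R'.V i ⟶ S.V i, IsOpenImmersion u.left ∧
        (∀ p, S.ι i (p ≫ u) = e (R'.ι i p)) ∧
        (∀ q, S.ι i q ∈ Set.range e → ∃ p, p ≫ u = q)

/-- Any two points lie in the image of a morphism `C → 𝒱` from an irreducible curve `C`. -/
def CurveConnected (S : IndVariety 𝒱) : Prop :=
  ∀ a b : 𝒱, ∃ C : Over SpecC, IsIrreducibleCurve C ∧
    ∃ (i : ℕ) (g : C ⟶ S.V i) (p q : Pt C), S.ι i (p ≫ g) = a ∧ S.ι i (q ≫ g) = b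

/-- An algebraic variety `V` regarded as an ind-variety (with the constant filtration), on a set
identified with its set of points. -/
def ofVariety (V : Over SpecC) (hV : IsVariety V) {X : Type u} (e : Pt V ≃ X) : IndVariety X where
  V _ := V
  isVariety _ := hV
  φ _ := 𝟙 V
  isClosedImmersion _ := inferInstanceAs (IsClosedImmersion (𝟙 V.left))
  ι _ := e
  ι_injective _ := e.injective
  ι_comp _ p := by simp
  exists_ι_eq x := ⟨0, e.symm x, by simp⟩

end IndVariety

/-! ## The algebraic tori `(ℂ*)^k` -/

/-- The algebra `ℂ[ℤ^k]` of Laurent polynomials in `k` variables. -/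
abbrev Laurent (k : ℕ) : Type := AddMonoidAlgebra ℂ (Fin k → ℤ)

/-- The variety `(ℂ*)^k = Spec ℂ[ℤ^k]`. -/
def stdTorus (k : ℕ) : Over SpecC :=
  Over.mk (Spec.map (CommRingCat.ofHom (algebraMap ℂ (Laurent k))))

theorem stdTorus_isVariety (k : ℕ) : IsVariety (stdTorus k) where
  isReduced := inferInstanceAs (IsReduced (Spec (.of (Laurent k))))
  isSeparated := inferInstanceAs (IsSeparated (Spec.map _))
  locallyOfFiniteType := by
    change LocallyOfFiniteType (Spec.map _)
    rw [HasRingHomProperty.Spec_iff (P := @LocallyOfFiniteType)]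
    change (algebraMap ℂ (Laurent k)).FiniteType
    rw [RingHom.finiteType_algebraMap]
    infer_instance
  quasiCompact := inferInstanceAs (QuasiCompact (Spec.map _))

/-- Points of `Spec A` are the `ℂ`-algebra homomorphisms `A → ℂ`. -/
def ptSpecEquiv (A : Type) [CommRing A] [Algebra ℂ A] :
    Pt (Over.mk (Spec.map (CommRingCat.ofHom (algebraMap ℂ A)))) ≃ (A →ₐ[ℂ] ℂ) where
  toFun p := AlgHom.mk (Spec.preimage p.left).hom (fun c => by
    have h : p.left ≫ Spec.map (CommRingCat.ofHom (algebraMap ℂ A)) = 𝟙 SpecC := Over.w p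
    rw [← Spec.map_preimage p.left, ← Spec.map_comp] at h
    exact congr($(Spec.map_injective (h.trans (Spec.map_id _).symm)).hom c))
  invFun f := Over.homMk (Spec.map (CommRingCat.ofHom f.toRingHom)) (by
    change Spec.map _ ≫ Spec.map _ = 𝟙 SpecC
    rw [← Spec.map_comp, ← Spec.map_id]
    congr 1
    ext c
    exact f.commutes c)
  left_inv p := by
    ext1
    exact Spec.map_preimage p.left
  right_inv f := by
    ext x
    change (Spec.preimage (Spec.map (CommRingCat.ofHom f.toRingHom))).hom x = f x
    rw [Spec.preimage_map]
    rfl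

/-- The point of `(ℂ*)^k` with coordinates `a` is the evaluation
`∑ c_m χ^m ↦ ∑ c_m a_0^(m_0) ⋯ a_(k-1)^(m_(k-1))` of Laurent polynomials at `a`. -/
def evalAt {k : ℕ} (a : Fin k → ℂˣ) : Laurent k →ₐ[ℂ] ℂ :=
  AddMonoidAlgebra.lift ℂ ℂ (Fin k → ℤ)
    { toFun := fun m => ((∏ n, a n ^ (m.toAdd n) : ℂˣ) : ℂ)
      map_one' := by simp
      map_mul' := fun m m' => by simp [zpow_add, Finset.prod_mul_distrib] }

/-- The `n`-th coordinate function, as a unit of `ℂ[ℤ^k]`. -/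
def coordUnit {k : ℕ} (n : Fin k) : (Laurent k)ˣ where
  val := AddMonoidAlgebra.single (Pi.single n 1) 1
  inv := AddMonoidAlgebra.single (Pi.single n (-1)) 1
  val_inv := by
    rw [AddMonoidAlgebra.single_mul_single, ← Pi.single_add]; simp [AddMonoidAlgebra.one_def]
  inv_val := by
    rw [AddMonoidAlgebra.single_mul_single, ← Pi.single_add]; simp [AddMonoidAlgebra.one_def]

/-- A homomorphism `ℂ[ℤ^k] → ℂ` is determined by the images of the `k` coordinates. -/
def algHomEquiv (k : ℕ) : (Laurent k →ₐ[ℂ] ℂ) ≃ (Fin k → ℂˣ) where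
  toFun f n := Units.map (f : Laurent k →* ℂ) (coordUnit n)
  invFun a := evalAt a
  left_inv f := by
    set a : Fin k → ℂˣ := fun n => Units.map (f : Laurent k →* ℂ) (coordUnit n) with ha
    let χ (h : Laurent k →ₐ[ℂ] ℂ) : (Fin k → ℤ) →+ Additive ℂˣ :=
      MonoidHom.toAdditiveRight
        ((h : Laurent k →* ℂ).comp (AddMonoidAlgebra.of ℂ (Fin k → ℤ))).toHomUnits
    have key : χ (evalAt a) = χ f := by
      refine AddMonoidHom.functions_ext' (M := fun _ : Fin k => ℤ) (Additive ℂˣ) (χ (evalAt a))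
        (χ f) fun n => AddMonoidHom.ext_int ?_
      apply Additive.toMul.injective
      ext
      simp [χ, evalAt, ha, coordUnit, Pi.single_apply]
    refine AddMonoidAlgebra.algHom_ext (fun m => ?_) (Subsingleton.elim _ _)
    have h := DFunLike.congr_fun key m
    exact congrArg (fun z : Additive ℂˣ => ((Additive.toMul z : ℂˣ) : ℂ)) h
  right_inv a := by
    funext n
    ext
    simp [evalAt, coordUnit, Pi.single_apply]

/-- The coordinates of the points of `(ℂ*)^k`. -/
def stdTorusPt (k : ℕ) : Pt (stdTorus k) ≃ (Fin k → ℂˣ) :=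
  (ptSpecEquiv (Laurent k)).trans (algHomEquiv k)

/-! ## The ind-torus `(ℂ*)^∞` -/

/-- The group `(ℂ*)^∞` of sequences `a` in `ℂ*` with `a n ≠ 1` for only finitely many `n`. -/
def TorusInf : Subgroup (ℕ → ℂˣ) where
  carrier := {a | ∃ k, ∀ n, k ≤ n → a n = 1}
  one_mem' := ⟨0, fun _ _ => rfl⟩
  mul_mem' := by
    rintro a b ⟨k, hk⟩ ⟨l, hl⟩
    refine ⟨max k l, fun n hn => ?_⟩
    simp [hk n (le_trans (le_max_left _ _) hn), hl n (le_trans (le_max_right _ _) hn)]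
  inv_mem' := by
    rintro a ⟨k, hk⟩
    exact ⟨k, fun n hn => by simp [hk n hn]⟩

/-- The inclusion `(ℂ*)^k → (ℂ*)^∞`, `(a_0, …, a_(k-1)) ↦ (a_0, …, a_(k-1), 1, 1, …)`. -/
def extendByOne (k : ℕ) (a : Fin k → ℂˣ) : TorusInf :=
  ⟨fun n => if h : n < k then a ⟨n, h⟩ else 1, k, fun n hn => by simp [hn]⟩

/-- The comorphism `ℂ[ℤ^(k+1)] → ℂ[ℤ^k]` setting the last coordinate to `1`. -/
def restrictLast (k : ℕ) : Laurent (k + 1) →ₐ[ℂ] Laurent k :=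
  AddMonoidAlgebra.mapDomainAlgHom ℂ ℂ (LinearMap.funLeft ℤ ℤ (Fin.castSucc (n := k))).toAddMonoidHom

/-- The closed embedding `(ℂ*)^k ↪ (ℂ*)^(k+1)`, `a ↦ (a, 1)`. -/
def stdTorusEmb (k : ℕ) : stdTorus k ⟶ stdTorus (k + 1) :=
  Over.homMk (Spec.map (CommRingCat.ofHom (restrictLast k).toRingHom)) (by
    change Spec.map _ ≫ Spec.map _ = Spec.map _
    rw [← Spec.map_comp]
    congr 1
    ext1
    exact RingHom.ext (restrictLast k).commutes)

theorem restrictLast_surjective (k : ℕ) : Function.Surjective (restrictLast k) := by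
  intro x
  induction x using AddMonoidAlgebra.induction_linear with
  | zero => exact ⟨0, map_zero _⟩
  | add x y hx hy =>
    obtain ⟨x', rfl⟩ := hx
    obtain ⟨y', rfl⟩ := hy
    exact ⟨x' + y', map_add _ _ _⟩
  | single m c =>
    obtain ⟨m', rfl⟩ :=
      LinearMap.funLeft_surjective_of_injective ℤ ℤ _ (Fin.castSucc_injective k) m
    exact ⟨AddMonoidAlgebra.single m' c, by simp [restrictLast]⟩

theorem stdTorusPt_comp (k : ℕ) (p : Pt (stdTorus k)) (n : Fin (k + 1)) :
    stdTorusPt (k + 1) (p ≫ stdTorusEmb k) n =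
      if h : (n : ℕ) < k then stdTorusPt k p ⟨n, h⟩ else 1 := by
  set f := ptSpecEquiv (Laurent k) p with hf
  have h : ptSpecEquiv (Laurent (k + 1)) (p ≫ stdTorusEmb k) = f.comp (restrictLast k) := by
    rw [← Equiv.eq_symm_apply]
    ext1
    have e : Spec.map (Spec.preimage (R := .of (Laurent k)) (S := .of ℂ) p.left) = p.left :=
      Spec.map_preimage _
    exact (congrArg (fun q => q ≫ Spec.map (CommRingCat.ofHom (restrictLast k).toRingHom)) e).symm.trans
      (Spec.map_comp _ _).symm
  change algHomEquiv (k + 1) (ptSpecEquiv (Laurent (k + 1)) (p ≫ stdTorusEmb k)) n =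
    if h : (n : ℕ) < k then algHomEquiv k f ⟨n, h⟩ else 1
  rw [h]
  ext
  have key : (LinearMap.funLeft ℤ ℤ (Fin.castSucc (n := k))) (Pi.single n 1) =
      if h : (n : ℕ) < k then Pi.single ⟨n, h⟩ 1 else 0 := by
    funext m
    split_ifs with h
    · simp [LinearMap.funLeft, Pi.single_apply, Fin.ext_iff]
    · have : m.castSucc ≠ n := fun h' => h (by rw [← h']; exact m.2)
      simp [LinearMap.funLeft, this]
  have e : ((algHomEquiv (k + 1) (f.comp (restrictLast k)) n : ℂˣ) : ℂ) =
      f (AddMonoidAlgebra.single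
        ((LinearMap.funLeft ℤ ℤ (Fin.castSucc (n := k))) (Pi.single n 1)) 1) := by
    simp [algHomEquiv, coordUnit, restrictLast]
  rw [e, key]
  split_ifs with h
  · rfl
  · exact map_one f

/-- The structure of ind-variety on `(ℂ*)^∞` given by `(ℂ*)^0 ↪ (ℂ*)^1 ↪ (ℂ*)^2 ↪ ⋯`. -/
def torusInf : IndVariety TorusInf where
  V := stdTorus
  isVariety := stdTorus_isVariety
  φ := stdTorusEmb
  isClosedImmersion k := by
    change IsClosedImmersion (Spec.map _)
    exact IsClosedImmersion.spec_of_surjective _ (restrictLast_surjective k)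
  ι k p := extendByOne k (stdTorusPt k p)
  ι_injective k p q h := by
    refine (stdTorusPt k).injective (funext fun n => ?_)
    simpa [extendByOne] using congrFun (congrArg Subtype.val h) n
  ι_comp k p := by
    refine Subtype.ext (funext fun n => ?_)
    simp only [extendByOne, stdTorusPt_comp]
    grind
  exists_ι_eq := by
    rintro ⟨a, k, hk⟩
    refine ⟨k, (stdTorusPt k).symm fun n => a n, Subtype.ext (funext fun n => ?_)⟩
    simp only [extendByOne, Equiv.apply_symm_apply]
    split_ifs with h
    · rfl
    · exact (hk n (not_lt.mp h)).symm

/-! ## Tori and ind-tori -/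

/-- `T`, with the given group structure on its set of points, is an algebraic torus: it is
isomorphic, as a variety and as a group, to some `(ℂ*)^k`, `k ≥ 0`. -/
def IsAlgebraicTorus (T : Over SpecC) [Group (Pt T)] : Prop :=
  ∃ (k : ℕ) (e : T ≅ stdTorus k), ∀ s t : Pt T,
    stdTorusPt k ((s * t) ≫ e.hom) = stdTorusPt k (s ≫ e.hom) * stdTorusPt k (t ≫ e.hom)

/-- The group `𝒯` with the given structure of ind-variety is an ind-torus: it is isomorphic, as an
ind-variety and as a group, to some algebraic torus `(ℂ*)^k` or to `(ℂ*)^∞`. -/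
def IsIndTorus {𝒯 : Type u} [Group 𝒯] (S : IndVariety 𝒯) : Prop :=
  (∃ (k : ℕ) (e : 𝒯 ≃* (Fin k → ℂˣ)),
    S.IsIsomorphism (.ofVariety (stdTorus k) (stdTorus_isVariety k) (stdTorusPt k)) e.toEquiv) ∨
  ∃ e : 𝒯 ≃* TorusInf, S.IsIsomorphism torusInf e.toEquiv

/-! ## Toric varieties and toric morphisms -/

/-- A structure of toric variety on `V`, with acting torus `T`: the variety `V` is irreducible
(normality is not required), `T` is an algebraic torus which is a (necessarily dense) open subset
of `V`, and the action of `T` on itself by translations extends to a regular action on `V`. -/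
structure ToricStructure (V T : Over SpecC) where
  isVariety : IsVariety V
  irreducible : IrreducibleSpace V.left
  group : Group (Pt T)
  isAlgebraicTorus : IsAlgebraicTorus T
  incl : T ⟶ V
  isOpenImmersion : IsOpenImmersion incl.left
  action : MulAction (Pt T) (Pt V)
  regular_action : ∃ a : T ⊗ V ⟶ V, ∀ (t : Pt T) (x : Pt V), lift t x ≫ a = t • x
  smul_incl : ∀ s t : Pt T, s • (t ≫ incl) = (s * t) ≫ incl

/-- A morphism `g : V ⟶ V'` of toric varieties is toric if it restricts to a morphism of algebraic
groups `T ⟶ T'` between the acting tori. -/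
def IsToricMorphism {V T V' T' : Over SpecC} (X : ToricStructure V T) (X' : ToricStructure V' T')
    (g : V ⟶ V') : Prop :=
  letI := X.group
  letI := X'.group
  ∃ h : T ⟶ T', h ≫ X'.incl = X.incl ≫ g ∧ ∀ s t : Pt T, (s * t) ≫ h = (s ≫ h) * (t ≫ h)

/-! ## Toric ind-varieties and toric morphisms -/

/-- Toric ind-varieties: a curve-connected ind-variety `𝒱` together with an ind-torus `𝒯` that is an
open subset of `𝒱`, such that the action of `𝒯` on itself by translations extends to a regular
action `𝒯 × 𝒱 → 𝒱`, i.e. a group action that is a morphism of ind-varieties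
for the product filtration `T i × V i`. -/
structure ToricIndVariety where
  /-- the underlying set of `𝒱` -/
  carrier : Type u
  ind : IndVariety carrier
  curveConnected : ind.CurveConnected
  /-- the underlying set of the acting ind-torus `𝒯` -/
  torus : Type u
  group : Group torus
  torusInd : IndVariety torus
  isIndTorus : IsIndTorus torusInd
  /-- the inclusion of `𝒯` into `𝒱` -/
  incl : torus → carrier
  isOpenEmbedding : torusInd.IsOpenEmbedding ind incl
  action : MulAction torus carrier
  regular_action : ∀ i, ∃ j, ∃ a : torusInd.V i ⊗ ind.V i ⟶ ind.V j,
    ∀ (t : Pt (torusInd.V i)) (x : Pt (ind.V i)),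
      ind.ι j (lift t x ≫ a) = torusInd.ι i t • ind.ι i x
  smul_incl : ∀ s t : torus, s • incl t = incl (s * t)

attribute [instance] ToricIndVariety.group

/-- A map `α : 𝒱 → 𝒱'` (a morphism of ind-varieties) is toric if it maps the ind-torus `𝒯` into `𝒯'`
and its restriction `𝒯 → 𝒯'` is a morphism of ind-groups, i.e. a group homomorphism that is
a morphism of ind-varieties. -/
def IsToricIndMorphism (X : ToricIndVariety.{u}) (X' : ToricIndVariety.{v})
    (α : X.carrier → X'.carrier) : Prop :=
  ∃ β : X.torus →* X'.torus, X.torusInd.IsMorphism X'.torusInd β ∧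
    ∀ t, X'.incl (β t) = α (X.incl t)

/-- A toric filtration of the toric ind-variety `𝒱` with ind-torus `𝒯`: a filtration
`V 0 ↪ V 1 ↪ ⋯` of `𝒱` (equivalent to the given one) by toric varieties `V i` with acting tori `T i`
such that the closed embeddings `V i ↪ V (i + 1)` are toric morphisms and `𝒯` is the
inductive limit of the `T i`, as an ind-variety and as a group. -/
structure ToricFiltration (X : ToricIndVariety.{u}) where
  filt : IndVariety X.carrier
  filt_equivalent : filt.Equivalent X.ind
  tori : IndVariety X.torus
  tori_equivalent : tori.Equivalent X.torusInd
  toric : ∀ i, ToricStructure (filt.V i) (tori.V i)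
  toric_φ : ∀ i, IsToricMorphism (toric i) (toric (i + 1)) (filt.φ i)
  incl_ι : ∀ i (t : Pt (tori.V i)), X.incl (tori.ι i t) = filt.ι i (t ≫ (toric i).incl)
  ι_mul : ∀ i (s t : Pt (tori.V i)),
    letI := (toric i).group
    tori.ι i (s * t) = tori.ι i s * tori.ι i t

end ToricInd

end

noncomputable section

namespace ToricInd

/-! ### Complex points -/

/-! The forward implication is formal. Equivalent filtrations have the same morphisms, so `α` and
its restriction to the ind-tori both restrict to stages with a common large index. Compatibility and
multiplicativity are then checked on complex points, which separate morphisms of varieties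
(`hom_ext_of_pt`).

Conversely, one pair of toric filtrations suffices: the homomorphisms between the tori at each stage
glue. The real content is therefore that toric filtrations exist (`nonempty_toricFiltration`);
otherwise the condition would be vacuous.

To build one, filter the ind-torus by algebraic tori `T_k`. Each is locally closed in a stratum,
hence open in its closure `W_k`. Three points remain. The `W_k` exhaust the ind-variety: an
irreducible curve joining a given point to the identity meets the ind-torus in a dense open subset,
which lies in one `T_k`, so the whole curve lies in `W_k`. The filtration is equivalent to the given
one: a stratum is an increasing union of countably many closed subsets coming from the `W_k`, and
since `ℂ` is uncountable one of them is everything (`exists_eq_univ_of_monotone`). The torus acts on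
its closure: translations by `T_k` preserve `T_k`, hence `W_k`, and the action is a morphism into
`W_k` because `T_k × W_k` is reduced. -/

/-- The point of the underlying space of `X` given by a complex point. -/
def Pt.point {X : Over SpecC} (p : Pt X) : X.left := p.left (IsLocalRing.closedPoint ℂ)

@[simp] theorem Pt.point_comp {X Y : Over SpecC} (p : Pt X) (f : X ⟶ Y) :
    Pt.point (p ≫ f) = f.left p.point := by
  rfl

theorem exists_point_eq {X : Over SpecC} [LocallyOfFiniteType X.hom] {x : X.left}
    (hx : IsClosed {x}) : ∃ p : Pt X, p.point = x :=
  ⟨Over.homMk (pointOfClosedPoint X.hom x hx) (by simp), pointOfClosedPoint_apply X.hom x hx _⟩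

theorem jacobsonSpace (X : Over SpecC) [LocallyOfFiniteType X.hom] : JacobsonSpace X.left :=
  LocallyOfFiniteType.jacobsonSpace (Y := Spec _) X.hom

/-- Schemes locally of finite type over `ℂ` are Jacobson, so closed points are dense, and by the
Nullstellensatz each closed point is a complex point. -/
theorem eq_univ_of_forall_point_mem {X : Over SpecC} [LocallyOfFiniteType X.hom] {Z : Set X.left}
    (hZ : IsClosed Z) (h : ∀ p : Pt X, p.point ∈ Z) : Z = Set.univ := by
  have := jacobsonSpace X
  rw [Set.eq_univ_iff_forall, ← hZ.closure_eq]
  rw [← Set.eq_univ_iff_forall, ← Set.univ_subset_iff, ← closure_closedPoints]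
  refine closure_mono fun x hx => ?_
  obtain ⟨p, rfl⟩ := exists_point_eq hx
  exact h p

theorem hom_ext_of_pt {X Y : Over SpecC} [IsReduced X.left] [LocallyOfFiniteType X.hom]
    [LocallyOfFiniteType Y.hom] [IsSeparated Y.hom] {f g : X ⟶ Y}
    (h : ∀ p : Pt X, p ≫ f = p ≫ g) : f = g := by
  ext1
  have : LocallyOfFiniteType (f.left ≫ Y.hom) := by simpa
  refine ext_of_apply_eq Y.hom Set.univ isOpen_univ.isLocallyClosed dense_univ
    (fun x _ hx => ?_) (by simp)
  obtain ⟨p, rfl⟩ := exists_point_eq hx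
  rw [← Pt.point_comp, h, Pt.point_comp]

/-- A morphism from a reduced scheme factors through a closed subscheme containing its image. -/
theorem exists_lift_of_range_subset {Y Z W : Over SpecC} [IsReduced Y.left] (f : Y ⟶ Z) (i : W ⟶ Z)
    [IsClosedImmersion i.left] (h : f.left ⁻¹' Set.range i.left = Set.univ) :
    ∃ g : Y ⟶ W, g ≫ i = f := by
  -- The base change of `i` along `f` is a surjective closed immersion onto a reduced scheme, hence
  -- an isomorphism; its inverse provides the lift.
  have : Surjective (Limits.pullback.fst f.left i.left) := by
    refine ⟨Set.range_eq_univ.mp ?_⟩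
    rw [Scheme.Pullback.range_fst, h]
  have : IsIso (Limits.pullback.fst f.left i.left) := isIso_of_isClosedImmersion_of_surjective _
  have e : (inv (Limits.pullback.fst f.left i.left) ≫ Limits.pullback.snd f.left i.left) ≫ i.left
      = f.left := by
    rw [Category.assoc, ← Limits.pullback.condition, IsIso.inv_hom_id_assoc]
  refine ⟨Over.homMk (inv (Limits.pullback.fst f.left i.left) ≫ Limits.pullback.snd _ _) ?_, ?_⟩
  · rw [← Over.w i, ← Category.assoc, e, Over.w f]
  · ext1
    exact e

/-- A morphism from a reduced scheme factors through a closed subscheme as soon as the images of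
the complex points of a dense part of the source lie in it. -/
theorem exists_lift_of_dominant {D Y Z W : Over SpecC} [LocallyOfFiniteType D.hom]
    [IsReduced Y.left] (d : D ⟶ Y) [IsDominant d.left] (f : Y ⟶ Z) (i : W ⟶ Z)
    [IsClosedImmersion i.left]
    (h : ∀ p : Pt D, ∃ q : Pt W, q ≫ i = p ≫ d ≫ f) : ∃ g : Y ⟶ W, g ≫ i = f := by
  have hr : IsClosed (Set.range i.left) := i.left.isClosedEmbedding.isClosed_range
  have hD : (d ≫ f).left ⁻¹' Set.range i.left = Set.univ := by
    refine eq_univ_of_forall_point_mem (hr.preimage (d ≫ f).left.continuous) fun p => ?_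
    obtain ⟨q, hq⟩ := h p
    exact ⟨q.point, by rw [← Pt.point_comp, hq, Pt.point_comp]⟩
  refine exists_lift_of_range_subset f i ?_
  rw [← (hr.preimage f.left.continuous).closure_eq, ← Set.univ_subset_iff,
    ← (d.left.denseRange).closure_range]
  refine closure_mono ?_
  rintro _ ⟨x, rfl⟩
  simpa using Set.eq_univ_iff_forall.mp hD x

/-! ### Points avoiding countably many closed subsets, and products with tori -/

open Cardinal in
-- For `x` transcendental, the elements `(x - c)⁻¹` with `c` in `F` are linearly independent, so the
-- dimension is at least the cardinality of `F`.
theorem isAlgebraic_of_rank_lt {F : Type u} {E : Type u} [Field F] [Field E] [Algebra F E]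
    (h : Module.rank F E < #F) : Algebra.IsAlgebraic F E := by
  rw [Algebra.isAlgebraic_def]
  intro x
  by_contra hx
  exact absurd (Transcendental.linearIndependent_sub_inv (F := F) (x := x) hx).cardinal_le_rank
    (not_le.mpr h)

theorem rank_mvPolynomial_le_aleph0 (σ : Type) [Countable σ] :
    Module.rank ℂ (MvPolynomial σ ℂ) ≤ Cardinal.aleph0 := by
  rw [MvPolynomial.rank_eq_lift, Cardinal.lift_le_aleph0, Cardinal.mk_le_aleph0_iff]
  infer_instance

/-- A Nullstellensatz in countable dimension: a residue field of `B` has countable dimension over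
the uncountable field `ℂ`, so it is algebraic over `ℂ`, hence equal to it. -/
theorem nonempty_algHom_of_rank_le {B : Type} [CommRing B] [Nontrivial B] [Algebra ℂ B]
    (h : Module.rank ℂ B ≤ Cardinal.aleph0) : Nonempty (B →ₐ[ℂ] ℂ) := by
  obtain ⟨m, hm⟩ := Ideal.exists_maximal B
  let _ : Field (B ⧸ m) := Ideal.Quotient.field m
  have hr : Module.rank ℂ (B ⧸ m) ≤ Cardinal.aleph0 :=
    (LinearMap.rank_le_of_surjective (Ideal.Quotient.mkₐ ℂ m).toLinearMap
      (Ideal.Quotient.mkₐ_surjective ℂ m)).trans h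
  have : Algebra.IsAlgebraic ℂ (B ⧸ m) := isAlgebraic_of_rank_lt
    (by rw [Cardinal.mk_complex]; exact hr.trans_lt Cardinal.aleph0_lt_continuum)
  have : Algebra.IsIntegral ℂ (B ⧸ m) := Algebra.IsAlgebraic.isIntegral
  let e := (AlgEquiv.ofBijective (Algebra.ofId ℂ (B ⧸ m))
    IsAlgClosed.algebraMap_bijective_of_isIntegral).symm
  exact ⟨e.toAlgHom.comp (Ideal.Quotient.mkₐ ℂ m)⟩

/-- Countably many functions outside a prime ideal of a finitely generated `ℂ`-algebra have a common
nonvanishing point. -/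
theorem exists_algHom_forall_ne_zero {A : Type} [CommRing A] [Algebra ℂ A] [Algebra.FiniteType ℂ A]
    (P : Ideal A) [hP : P.IsPrime] (f : ℕ → A) (hf : ∀ k, f k ∉ P) :
    ∃ φ : A →ₐ[ℂ] ℂ, ∀ k, φ (f k) ≠ 0 := by
  let F := P.ResidueField
  obtain ⟨t, ht⟩ := (inferInstance : Algebra.FiniteType ℂ A).out
  -- `B` is generated inside the residue field of `P` by the image of `A` and the inverses of all `f
  -- k`. It has countable dimension, and any character of it is nonzero on every `f k`.
  let s : t ⊕ ℕ → F := Sum.elim (fun a => algebraMap A F a) (fun k => (algebraMap A F (f k))⁻¹)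
  let B : Subalgebra ℂ F := (MvPolynomial.aeval s).range
  have hA (a : A) : IsScalarTower.toAlgHom ℂ A F a ∈ B := by
    have h : (⊤ : Subalgebra ℂ A).map (IsScalarTower.toAlgHom ℂ A F) ≤ B := by
      rw [← ht, AlgHom.map_adjoin, Algebra.adjoin_le_iff]
      rintro _ ⟨a, ha, rfl⟩
      exact ⟨MvPolynomial.X (Sum.inl ⟨a, ha⟩), by simp [s]⟩
    exact h ⟨a, trivial, rfl⟩
  let ψ : A →ₐ[ℂ] B := (IsScalarTower.toAlgHom ℂ A F).codRestrict B hA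
  have hψ (k : ℕ) : IsUnit (ψ (f k)) := by
    refine IsUnit.of_mul_eq_one ⟨(algebraMap A F (f k))⁻¹,
      MvPolynomial.X (Sum.inr k), by simp [s]⟩ (Subtype.ext ?_)
    refine mul_inv_cancel₀ ?_
    exact (Ideal.algebraMap_residueField_eq_zero (I := P)).not.mpr (hf k)
  have hr : Module.rank ℂ B ≤ Cardinal.aleph0 :=
    (LinearMap.rank_le_of_surjective (MvPolynomial.aeval s).rangeRestrict.toLinearMap
      (AlgHom.rangeRestrict_surjective _)).trans (rank_mvPolynomial_le_aleph0 (t ⊕ ℕ))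
  obtain ⟨χ⟩ := nonempty_algHom_of_rank_le hr
  exact ⟨χ.comp ψ, fun k => ((hψ k).map χ).ne_zero⟩

/-- Base change to `K` gives the Laurent polynomial ring over `K`, which is reduced. This is what
makes products of a torus with a variety reduced. -/
theorem geometricallyReduced_stdTorus (k : ℕ) : GeometricallyReduced (stdTorus k).hom := by
  constructor
  change geometrically _ (Spec.map _)
  rw [geometrically_iff_of_commRing]
  intro K _ _ Y fst snd h
  have : _root_.IsReduced (TensorProduct ℂ (Laurent k) K) := by
    have e := (Algebra.TensorProduct.comm ℂ (Laurent k) K).toRingEquiv.trans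
      (AddMonoidAlgebra.scalarTensorEquiv ℂ K (M := Fin k → ℤ)).toRingEquiv
    exact isReduced_of_injective e e.injective
  let i : Y ≅ _ := h.isoPullback ≪≫ pullbackSpecIso ℂ (Laurent k) K
  exact isReduced_of_isOpenImmersion i.hom

theorem isReduced_stdTorus_tensorObj (k : ℕ) (V : Over SpecC) [IsReduced V.left]
    [LocallyOfFiniteType V.hom] : IsReduced (stdTorus k ⊗ V).left := by
  have := geometricallyReduced_stdTorus k
  have : IsLocallyNoetherian V.left := LocallyOfFiniteType.isLocallyNoetherian (Y := Spec _) V.hom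
  dsimp
  infer_instance

/-- If countably many closed subsets of a scheme locally of finite type over `ℂ` do not cover it,
they do not cover its complex points. -/
theorem exists_pt_forall_notMem {V : Over SpecC} [LocallyOfFiniteType V.hom] (Z : ℕ → Set V.left)
    (hZ : ∀ k, IsClosed (Z k)) (y : V.left) (hy : ∀ k, y ∉ Z k) :
    ∃ p : Pt V, ∀ k, p.point ∉ Z k := by
  obtain ⟨R, i, _, ⟨y, rfl⟩, -⟩ := V.left.exists_affine_mem_range_and_range_subset (x := y) (U := ⊤) trivial
  let _ : Algebra ℂ R := (Spec.preimage (i ≫ V.hom)).hom.toAlgebra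
  have e : Spec.map (CommRingCat.ofHom (algebraMap ℂ R)) = i ≫ V.hom := Spec.map_preimage _
  have : Algebra.FiniteType ℂ R := by
    rw [← RingHom.finiteType_algebraMap]
    have : LocallyOfFiniteType (Spec.map (CommRingCat.ofHom (algebraMap ℂ R))) := by
      rw [e]; infer_instance
    rwa [HasRingHomProperty.Spec_iff (P := @LocallyOfFiniteType)] at this
  -- In an affine neighbourhood of `y`, each `Z k` lies in the zero locus of a function that does
  -- not vanish at `y`.
  have hf (k : ℕ) : ∃ f : R, f ∉ y.asIdeal ∧ ∀ x : Spec R, i x ∈ Z k → f ∈ x.asIdeal := by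
    obtain ⟨s, hs⟩ := (PrimeSpectrum.isClosed_iff_zeroLocus _).mp ((hZ k).preimage i.continuous)
    have := hy k
    change y ∉ i ⁻¹' (Z k) at this
    rw [hs] at this
    obtain ⟨f, hfs, hf⟩ := Set.not_subset.mp this
    refine ⟨f, hf, fun x hx => ?_⟩
    change x ∈ i ⁻¹' (Z k) at hx
    rw [hs] at hx
    exact hx hfs
  choose f hfy hf using hf
  obtain ⟨φ, hφ⟩ := exists_algHom_forall_ne_zero (PrimeSpectrum.asIdeal y) f hfy (hP := y.isPrime)
  let j : Over.mk (Spec.map (CommRingCat.ofHom (algebraMap ℂ R))) ⟶ V := Over.homMk i e.symm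
  refine ⟨(ptSpecEquiv R).symm φ ≫ j, fun k hk => hφ k ?_⟩
  have h : φ (f k) ∈ IsLocalRing.maximalIdeal ℂ := hf k _ hk
  simpa using h

/-- A scheme of finite type over `ℂ` is not an increasing union of countably many proper closed
subsets. -/
theorem exists_eq_univ_of_monotone {V : Over SpecC} [LocallyOfFiniteType V.hom]
    [QuasiCompact V.hom] (Z : ℕ → Set V.left) (hZ : ∀ k, IsClosed (Z k)) (hm : Monotone Z)
    (h : ∀ p : Pt V, ∃ k, p.point ∈ Z k) : ∃ k, Z k = Set.univ := by
  have hy (y : V.left) : ∃ k, y ∈ Z k := by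
    by_contra! hy
    obtain ⟨p, hp⟩ := exists_pt_forall_notMem Z hZ y hy
    obtain ⟨k, hk⟩ := h p
    exact hp k hk
  have : IsLocallyNoetherian V.left := LocallyOfFiniteType.isLocallyNoetherian (Y := Spec _) V.hom
  have : CompactSpace V.left := QuasiCompact.compactSpace_of_compactSpace V.hom
  have : IsNoetherian V.left := {}
  have hfin := TopologicalSpace.NoetherianSpace.finite_irreducibleComponents (α := V.left)
  -- A closed set containing the generic point of a component contains the component. There are
  -- finitely many components, so by monotonicity one index serves them all.
  have hc : ∀ C ∈ irreducibleComponents V.left, ∃ k, C ⊆ Z k := by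
    intro C hC
    obtain ⟨y, hyC⟩ := QuasiSober.sober hC.1 (isClosed_of_mem_irreducibleComponents C hC)
    obtain ⟨k, hk⟩ := hy y
    exact ⟨k, by rw [← hyC.def]; exact (hZ k).closure_subset_iff.mpr (by simpa using hk)⟩
  choose! k hk using hc
  obtain ⟨n, hn⟩ := (hfin.image k).bddAbove
  refine ⟨n, Set.eq_univ_of_forall fun y => ?_⟩
  have hyC := irreducibleComponent_mem_irreducibleComponents y
  exact hm (hn ⟨_, hyC, rfl⟩) (hk _ hyC mem_irreducibleComponent)

/-! ### Morphisms of ind-varieties -/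

instance (X : Over SpecC) [IsVariety X] : IsReduced X.left := IsVariety.isReduced

instance (X : Over SpecC) [IsVariety X] : IsSeparated X.hom := IsVariety.isSeparated

instance (X : Over SpecC) [IsVariety X] : LocallyOfFiniteType X.hom :=
  IsVariety.locallyOfFiniteType

instance (X : Over SpecC) [IsVariety X] : QuasiCompact X.hom := IsVariety.quasiCompact

instance {𝒱 : Type u} (S : IndVariety 𝒱) (i : ℕ) : IsVariety (S.V i) := S.isVariety i

namespace IndVariety

variable {𝒱 : Type u} {𝒲 : Type v} {𝒳 : Type w}

theorem exists_transition (S : IndVariety 𝒱) {i j : ℕ} (h : i ≤ j) :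
    ∃ g : S.V i ⟶ S.V j, IsClosedImmersion g.left ∧ ∀ p, S.ι j (p ≫ g) = S.ι i p := by
  induction j, h using Nat.le_induction with
  | base => exact ⟨𝟙 _, inferInstanceAs (IsClosedImmersion (𝟙 (S.V i).left)), fun p => by simp⟩
  | succ j _ ih =>
    obtain ⟨g, hg, hι⟩ := ih
    have := S.isClosedImmersion j
    refine ⟨g ≫ S.φ j, inferInstanceAs (IsClosedImmersion (g.left ≫ (S.φ j).left)), fun p => ?_⟩
    rw [← Category.assoc, S.ι_comp, hι]

theorem hom_ext (S : IndVariety 𝒱) {Y : Over SpecC} [IsReduced Y.left] [LocallyOfFiniteType Y.hom]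
    {i : ℕ} {f g : Y ⟶ S.V i} (h : ∀ p : Pt Y, S.ι i (p ≫ f) = S.ι i (p ≫ g)) : f = g :=
  hom_ext_of_pt fun p => S.ι_injective i (h p)

theorem IsMorphism.comp {S : IndVariety 𝒱} {R : IndVariety 𝒲} {Q : IndVariety 𝒳} {f : 𝒱 → 𝒲}
    {g : 𝒲 → 𝒳} (hg : R.IsMorphism Q g) (hf : S.IsMorphism R f) : S.IsMorphism Q (g ∘ f) := by
  intro i
  obtain ⟨j, a, ha⟩ := hf i
  obtain ⟨k, b, hb⟩ := hg j
  exact ⟨k, a ≫ b, fun p => by rw [← Category.assoc, hb, ha]; rfl⟩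

theorem Equivalent.isMorphism {S R : IndVariety 𝒱} (h : S.Equivalent R) : S.IsMorphism R id := h.1

theorem Equivalent.isMorphism_symm {S R : IndVariety 𝒱} (h : S.Equivalent R) :
    R.IsMorphism S id := h.2

theorem Equivalent.trans {S R Q : IndVariety 𝒱} (h : S.Equivalent R) (h' : R.Equivalent Q) :
    S.Equivalent Q := ⟨h'.isMorphism.comp h.isMorphism, h.isMorphism_symm.comp h'.isMorphism_symm⟩

/-- A morphism of ind-varieties maps a stratum into every sufficiently large stratum. -/
theorem IsMorphism.exists_forall_ge {S : IndVariety 𝒱} {R : IndVariety 𝒲} {f : 𝒱 → 𝒲}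
    (hf : S.IsMorphism R f) (i : ℕ) :
    ∃ j₀, ∀ j, j₀ ≤ j → ∃ g : S.V i ⟶ R.V j, ∀ p, R.ι j (p ≫ g) = f (S.ι i p) := by
  obtain ⟨j₀, g, hg⟩ := hf i
  refine ⟨j₀, fun j hj => ?_⟩
  obtain ⟨a, -, ha⟩ := R.exists_transition hj
  exact ⟨g ≫ a, fun p => by rw [← Category.assoc, ha, hg]⟩

end IndVariety

/-! ### The two implications for given toric filtrations -/

open IndVariety
theorem IsToricIndMorphism.exists_isToricMorphism {X : ToricIndVariety.{u}}
    {X' : ToricIndVariety.{v}} {α : X.carrier → X'.carrier} (hα : X.ind.IsMorphism X'.ind α)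
    (h : IsToricIndMorphism X X' α) (F : ToricFiltration X) (F' : ToricFiltration X') (i : ℕ) :
    ∃ (j : ℕ) (g : F.filt.V i ⟶ F'.filt.V j),
      (∀ p : Pt (F.filt.V i), F'.filt.ι j (p ≫ g) = α (F.filt.ι i p)) ∧
        IsToricMorphism (F.toric i) (F'.toric j) g := by
  obtain ⟨β, hβ, hβα⟩ := h
  have hα' : F.filt.IsMorphism F'.filt α :=
    F'.filt_equivalent.isMorphism_symm.comp (hα.comp F.filt_equivalent.isMorphism)
  have hβ' : F.tori.IsMorphism F'.tori β :=
    F'.tori_equivalent.isMorphism_symm.comp (hβ.comp F.tori_equivalent.isMorphism)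
  obtain ⟨j₁, h₁⟩ := hα'.exists_forall_ge i
  obtain ⟨j₂, h₂⟩ := hβ'.exists_forall_ge i
  -- The strata and the tori need the same target index, since the restriction to tori must be a map
  -- into the torus of the stage that receives `g`.
  obtain ⟨g, hg⟩ := h₁ (max j₁ j₂) (le_max_left _ _)
  obtain ⟨k, hk⟩ := h₂ (max j₁ j₂) (le_max_right _ _)
  refine ⟨max j₁ j₂, g, hg, k, F'.filt.hom_ext fun p => ?_, fun s t => ?_⟩
  · rw [← Category.assoc, ← F'.incl_ι, hk, hβα, F.incl_ι, ← Category.assoc, hg]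
  · apply F'.tori.ι_injective
    rw [F'.ι_mul, hk, hk, hk, F.ι_mul, map_mul]

theorem isToricIndMorphism_of_forall {X : ToricIndVariety.{u}} {X' : ToricIndVariety.{v}}
    {α : X.carrier → X'.carrier} (F : ToricFiltration X) (F' : ToricFiltration X')
    (h : ∀ i : ℕ, ∃ (j : ℕ) (g : F.filt.V i ⟶ F'.filt.V j),
      (∀ p : Pt (F.filt.V i), F'.filt.ι j (p ≫ g) = α (F.filt.ι i p)) ∧
        IsToricMorphism (F.toric i) (F'.toric j) g) :
    IsToricIndMorphism X X' α := by
  choose j g hg k hk hmul using h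
  have key (i : ℕ) (p : Pt (F.tori.V i)) :
      X'.incl (F'.tori.ι (j i) (p ≫ k i)) = α (X.incl (F.tori.ι i p)) := by
    rw [F'.incl_ι, F.incl_ι, Category.assoc, hk, ← hg, Category.assoc]
  -- Injectivity makes the restriction of `α` to the ind-torus unique, so the stagewise
  -- homomorphisms `k i` agree with it and need no separate compatibility check.
  have hinj : Function.Injective X'.incl := X'.isOpenEmbedding.1
  have hex (t : X.torus) : ∃ t' : X'.torus, X'.incl t' = α (X.incl t) := by
    obtain ⟨i, p, rfl⟩ := F.tori.exists_ι_eq t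
    exact ⟨_, key i p⟩
  choose β hβ using hex
  have hβι (i : ℕ) (p : Pt (F.tori.V i)) : F'.tori.ι (j i) (p ≫ k i) = β (F.tori.ι i p) :=
    hinj ((key i p).trans (hβ _).symm)
  have hβmul (s t : X.torus) : β (s * t) = β s * β t := by
    obtain ⟨a, p, rfl⟩ := F.tori.exists_ι_eq s
    obtain ⟨b, q, rfl⟩ := F.tori.exists_ι_eq t
    -- Both factors are moved to a common torus, where multiplicativity is known.
    obtain ⟨ga, -, ha⟩ := F.tori.exists_transition (le_max_left a b)
    obtain ⟨gb, -, hb⟩ := F.tori.exists_transition (le_max_right a b)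
    rw [← ha, ← hb, ← F.ι_mul, ← hβι, hmul, F'.ι_mul, hβι, hβι]
  have hmor : F.tori.IsMorphism F'.tori β := fun i => ⟨j i, k i, hβι i⟩
  exact ⟨MonoidHom.mk' β hβmul, F'.tori_equivalent.isMorphism.comp
    (hmor.comp F.tori_equivalent.isMorphism_symm), hβ⟩

/-! ### Filtrations of ind-tori by algebraic tori -/

/-- A filtration of an ind-torus by algebraic tori, as an ind-variety and as a group. -/
structure TorusFiltration {𝒯 : Type u} [Group 𝒯] (S : IndVariety 𝒯) where
  tori : IndVariety 𝒯
  equivalent : tori.Equivalent S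
  group : ∀ k, Group (Pt (tori.V k))
  isAlgebraicTorus : ∀ k, IsAlgebraicTorus (tori.V k)
  ι_mul : ∀ k (s t : Pt (tori.V k)), tori.ι k (s * t) = tori.ι k s * tori.ι k t

/-- Transport of a structure of ind-variety along a bijection. -/
def IndVariety.congr {𝒱 : Type u} {𝒲 : Type v} (S : IndVariety 𝒱) (e : 𝒱 ≃ 𝒲) :
    IndVariety 𝒲 where
  V := S.V
  isVariety := S.isVariety
  φ := S.φ
  isClosedImmersion := S.isClosedImmersion
  ι i p := e (S.ι i p)
  ι_injective i := e.injective.comp (S.ι_injective i)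
  ι_comp i p := by rw [S.ι_comp]
  exists_ι_eq x := by
    obtain ⟨i, p, h⟩ := S.exists_ι_eq (e.symm x)
    exact ⟨i, p, by simp [h]⟩

theorem IndVariety.IsIsomorphism.congr_symm_equivalent {𝒱 : Type u} {𝒲 : Type v} {S : IndVariety 𝒱}
    {R : IndVariety 𝒲} {e : 𝒱 ≃ 𝒲} (h : S.IsIsomorphism R e) : (R.congr e.symm).Equivalent S := by
  refine ⟨fun i => ?_, fun i => ?_⟩
  · obtain ⟨j, g, hg⟩ := h.2 i
    exact ⟨j, g, hg⟩
  · obtain ⟨j, g, hg⟩ := h.1 i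
    exact ⟨j, g, fun p => (congrArg e.symm (hg p)).trans (e.symm_apply_apply _)⟩

theorem extendByOne_mul (k : ℕ) (a b : Fin k → ℂˣ) :
    extendByOne k (a * b) = extendByOne k a * extendByOne k b := by
  refine Subtype.ext (funext fun n => ?_)
  by_cases h : n < k <;> simp [extendByOne, h]

/-- The group structure on the points of `(ℂ*)^k`. -/
abbrev stdTorusGroup (k : ℕ) : Group (Pt (stdTorus k)) := (stdTorusPt k).group

theorem stdTorusPt_mul (k : ℕ) (s t : Pt (stdTorus k)) :
    letI := stdTorusGroup k
    stdTorusPt k (s * t) = stdTorusPt k s * stdTorusPt k t :=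
  (stdTorusPt k).apply_symm_apply _

theorem isAlgebraicTorus_stdTorus (k : ℕ) :
    letI := stdTorusGroup k
    IsAlgebraicTorus (stdTorus k) := by
  let := stdTorusGroup k
  exact ⟨k, Iso.refl _, fun s t => by simp [stdTorusPt_mul]⟩

/-- The standard filtration is transported along the isomorphism; it is constant in the
finite-dimensional case. -/
theorem IsIndTorus.nonempty_torusFiltration {𝒯 : Type u} [Group 𝒯] {S : IndVariety 𝒯}
    (h : IsIndTorus S) : Nonempty (TorusFiltration S) := by
  obtain ⟨n, e, he⟩ | ⟨e, he⟩ := h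
  · exact ⟨_, he.congr_symm_equivalent, fun k => stdTorusGroup n,
      fun k => isAlgebraicTorus_stdTorus n, fun k s t => (congrArg e.symm (stdTorusPt_mul n s t)).trans
        (map_mul e.symm _ _)⟩
  · exact ⟨_, he.congr_symm_equivalent, fun k => stdTorusGroup k,
      fun k => isAlgebraicTorus_stdTorus k, fun k s t => (congrArg (fun a => e.symm (extendByOne k a))
        (stdTorusPt_mul k s t)).trans ((congrArg e.symm (extendByOne_mul _ _ _)).trans
        (map_mul e.symm _ _))⟩

theorem IsAlgebraicTorus.isIntegral {T : Over SpecC} [Group (Pt T)] (h : IsAlgebraicTorus T) :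
    IsIntegral T.left := by
  obtain ⟨k, e, -⟩ := h
  have : IsIntegral (stdTorus k).left := inferInstanceAs (IsIntegral (Spec (.of (Laurent k))))
  have : IsIso e.inv.left := inferInstanceAs (IsIso ((Over.forget SpecC).map e.inv))
  exact .of_isIso e.inv.left

theorem IsAlgebraicTorus.isReduced_tensorObj {T : Over SpecC} [Group (Pt T)]
    (h : IsAlgebraicTorus T) (V : Over SpecC) [IsVariety V] : IsReduced (T ⊗ V).left := by
  obtain ⟨k, e, -⟩ := h
  have := isReduced_stdTorus_tensorObj k V
  have : IsIso (e.hom ▷ V).left := inferInstanceAs (IsIso ((Over.forget SpecC).map (e.hom ▷ V)))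
  exact isReduced_of_isOpenImmersion (e.hom ▷ V).left

theorem locallyOfFiniteType_tensorObj (T V : Over SpecC) [LocallyOfFiniteType T.hom]
    [LocallyOfFiniteType V.hom] : LocallyOfFiniteType (T ⊗ V).hom := by
  dsimp
  infer_instance

/-! ### Closures -/

theorem irreducibleSpace_of_denseRange {α β : Type*} [TopologicalSpace α] [TopologicalSpace β]
    [IrreducibleSpace α] {f : α → β} (hf : Continuous f) (h : DenseRange f) :
    IrreducibleSpace β := by
  rw [irreducibleSpace_def, Set.top_eq_univ, ← h.closure_range, ← Set.image_univ]
  exact ((IrreducibleSpace.isIrreducible_univ α).image f hf.continuousOn).closure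

/-- Functions on the image inject into functions on `X` over preimages of affine opens of `Y`, and
these preimages are affine and cover the image. Hence the image inherits reducedness. -/
theorem isSchemeTheoreticallyDominant_toImage {X Y : Scheme.{u}} (f : X ⟶ Y) [QuasiCompact f] :
    IsSchemeTheoreticallyDominant f.toImage := by
  rw [isSchemeTheoreticallyDominant_iff]
  refine Scheme.IdealSheafData.ext_of_iSup_eq_top
    (fun U : Y.affineOpens => ⟨f.imageι ⁻¹ᵁ U, U.2.preimage _⟩) ?_ fun U => ?_
  · exact f.imageι.iSup_preimage_eq_top (iSup_affineOpens_eq_top Y)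
  · rw [Scheme.Hom.ker_apply, Scheme.IdealSheafData.ideal_bot, Pi.bot_apply,
      ← RingHom.injective_iff_ker_eq_bot]
    exact f.toImage_app_injective U

/-- An irreducible locally closed subvariety is open in its closure. -/
theorem exists_closure {T V : Over SpecC} [IsVariety T] [IsVariety V] [IsIntegral T.left]
    (f : T ⟶ V) [IsImmersion f.left] :
    ∃ (W : Over SpecC) (a : T ⟶ W) (c : W ⟶ V), IsVariety W ∧ IrreducibleSpace W.left ∧
      IsOpenImmersion a.left ∧ IsDominant a.left ∧ IsClosedImmersion c.left ∧ a ≫ c = f := by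
  have : QuasiCompact (f.left ≫ V.hom) := by rw [Over.w]; infer_instance
  have : QuasiCompact f.left := .of_comp f.left V.hom
  have hw : f.left.toImage ≫ f.left.imageι ≫ V.hom = T.hom := by
    rw [Scheme.Hom.toImage_imageι_assoc, Over.w]
  have := isSchemeTheoreticallyDominant_toImage f.left
  have : IsReduced f.left.image := IsSchemeTheoreticallyDominant.isReduced f.left.toImage
  have : IrreducibleSpace f.left.image :=
    irreducibleSpace_of_denseRange f.left.toImage.continuous f.left.toImage.denseRange
  let W : Over SpecC := Over.mk (f.left.imageι ≫ V.hom)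
  refine ⟨W, Over.homMk f.left.toImage hw, Over.homMk f.left.imageι, ⟨?_, ?_, ?_, ?_⟩, ?_,
    ?_, ?_, ?_, ?_⟩
  · exact inferInstanceAs (IsReduced f.left.image)
  · exact inferInstanceAs (IsSeparated (f.left.imageι ≫ V.hom))
  · exact inferInstanceAs (LocallyOfFiniteType (f.left.imageι ≫ V.hom))
  · exact inferInstanceAs (QuasiCompact (f.left.imageι ≫ V.hom))
  · exact inferInstanceAs (IrreducibleSpace f.left.image)
  · exact inferInstanceAs (IsOpenImmersion f.left.toImage)
  · exact inferInstanceAs (IsDominant f.left.toImage)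
  · exact inferInstanceAs (IsClosedImmersion f.left.imageι)
  · ext1
    exact f.left.toImage_imageι

/-- Cancellation works because `g` is separated, its source being separated over `ℂ`. -/
theorem isClosedImmersion_left_of_comp {X Y Z : Over SpecC} [IsVariety Y] (f : X ⟶ Y) (g : Y ⟶ Z)
    (h : IsClosedImmersion (f ≫ g).left) : IsClosedImmersion f.left := by
  have : IsSeparated (g.left ≫ Z.hom) := by rw [Over.w]; infer_instance
  have : IsSeparated g.left := .of_comp g.left Z.hom
  have : IsClosedImmersion (f.left ≫ g.left) := h
  exact .of_comp f.left g.left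

/-- The strata of a filtration of the ind-torus are locally closed in the toric ind-variety. -/
theorem exists_isImmersion (X : ToricIndVariety.{u}) (F : TorusFiltration X.torusInd) (k : ℕ) :
    ∃ (i : ℕ) (f : F.tori.V k ⟶ X.ind.V i), IsImmersion f.left ∧
      ∀ p, X.ind.ι i (p ≫ f) = X.incl (F.tori.ι k p) := by
  obtain ⟨-, R, hR, hu⟩ := X.isOpenEmbedding
  have hFR := F.equivalent.trans hR
  obtain ⟨i, g, hg⟩ := hFR.isMorphism k
  obtain ⟨l₀, hl⟩ := hFR.isMorphism_symm.exists_forall_ge i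
  obtain ⟨h, hh⟩ := hl (max k l₀) (le_max_right _ _)
  obtain ⟨t, ht, htι⟩ := F.tori.exists_transition (le_max_left k l₀)
  -- Going into the open stratum and back to a larger torus is a closed transition map, so `g` is
  -- closed; composing with the open immersion `u` gives an immersion.
  have hgh : g ≫ h = t := F.tori.hom_ext fun p => by rw [htι, ← Category.assoc, hh, hg]; rfl
  have : IsClosedImmersion g.left := isClosedImmersion_left_of_comp g h (by rwa [hgh])
  obtain ⟨u, hu₁, hu₂, -⟩ := hu i
  refine ⟨i, g ≫ u, inferInstanceAs (IsImmersion (g.left ≫ u.left)), fun p => ?_⟩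
  rw [← Category.assoc, hu₂, hg]
  rfl

/-! ### The filtration by closures of tori -/

instance (X : ToricIndVariety.{u}) : MulAction X.torus X.carrier := X.action

/-- A morphism into a stratum factors through a closed subvariety of another stratum as soon as the
images of the complex points of a dense part of the source lie in it. -/
theorem IndVariety.exists_lift {𝒱 : Type u} (S : IndVariety 𝒱) {D Y W : Over SpecC}
    [LocallyOfFiniteType D.hom] [IsReduced Y.left] {i j : ℕ} (d : D ⟶ Y) [IsDominant d.left]
    (f : Y ⟶ S.V i) (c : W ⟶ S.V j) [IsClosedImmersion c.left]
    (h : ∀ p : Pt D, ∃ q : Pt W, S.ι j (q ≫ c) = S.ι i (p ≫ d ≫ f)) :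
    ∃ g : Y ⟶ W, ∀ p : Pt Y, S.ι j (p ≫ g ≫ c) = S.ι i (p ≫ f) := by
  obtain ⟨a, ha, haι⟩ := S.exists_transition (le_max_left i j)
  obtain ⟨b, hb, hbι⟩ := S.exists_transition (le_max_right i j)
  have : IsClosedImmersion (c ≫ b).left := inferInstanceAs (IsClosedImmersion (c.left ≫ b.left))
  obtain ⟨g, hg⟩ := exists_lift_of_dominant d (f ≫ a) (c ≫ b) fun p => by
    obtain ⟨q, hq⟩ := h p
    refine ⟨q, S.ι_injective _ ?_⟩
    rw [← Category.assoc, hbι, hq, ← haι]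
    simp
  refine ⟨g, fun p => ?_⟩
  rw [← hbι, ← haι]
  simp [hg]

/-- If a closed subvariety of a stratum is contained in a closed subvariety of another one,
the inclusion is a closed immersion. -/
theorem IndVariety.isClosedImmersion_of_ι_comp {𝒱 : Type u} (S : IndVariety 𝒱) {Y W : Over SpecC}
    [IsVariety Y] [IsVariety W] {i j : ℕ} (f : Y ⟶ S.V i) [IsClosedImmersion f.left]
    (c : W ⟶ S.V j) (g : Y ⟶ W) (h : ∀ p : Pt Y, S.ι j (p ≫ g ≫ c) = S.ι i (p ≫ f)) :
    IsClosedImmersion g.left := by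
  obtain ⟨a, ha, haι⟩ := S.exists_transition (le_max_left i j)
  obtain ⟨b, hb, hbι⟩ := S.exists_transition (le_max_right i j)
  have e : g ≫ c ≫ b = f ≫ a := S.hom_ext fun p => by
    rw [← Category.assoc p f a, haι, ← h, ← hbι]
    simp
  refine isClosedImmersion_left_of_comp g (c ≫ b) ?_
  rw [e]
  exact inferInstanceAs (IsClosedImmersion (f.left ≫ a.left))

/-- The closures, in the strata of a toric ind-variety, of the tori filtering its ind-torus. -/
structure TorusClosures (X : ToricIndVariety.{u}) (F : TorusFiltration X.torusInd) where
  W : ℕ → Over SpecC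
  idx : ℕ → ℕ
  torusIncl : ∀ k, F.tori.V k ⟶ W k
  incl : ∀ k, W k ⟶ X.ind.V (idx k)
  isVariety : ∀ k, IsVariety (W k)
  irreducible : ∀ k, IrreducibleSpace (W k).left
  isOpenImmersion : ∀ k, IsOpenImmersion (torusIncl k).left
  isDominant : ∀ k, IsDominant (torusIncl k).left
  isClosedImmersion : ∀ k, IsClosedImmersion (incl k).left
  ι_incl : ∀ k p, X.ind.ι (idx k) (p ≫ torusIncl k ≫ incl k) = X.incl (F.tori.ι k p)

theorem nonempty_torusClosures (X : ToricIndVariety.{u}) (F : TorusFiltration X.torusInd) :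
    Nonempty (TorusClosures X F) := by
  choose i f hf hι using exists_isImmersion X F
  have hW (k : ℕ) := by
    let := F.group k
    have := (F.isAlgebraicTorus k).isIntegral
    exact exists_closure (f k)
  choose W a c h₁ h₂ h₃ h₄ h₅ h₆ using hW
  exact ⟨⟨W, i, a, c, h₁, h₂, h₃, h₄, h₅, fun k p => by rw [h₆, hι]⟩⟩

namespace TorusClosures

variable {X : ToricIndVariety.{u}} {F : TorusFiltration X.torusInd} (K : TorusClosures X F)

instance (k : ℕ) : IsVariety (K.W k) := K.isVariety k

instance (k : ℕ) : IsClosedImmersion (K.incl k).left := K.isClosedImmersion k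

instance (k : ℕ) : IsDominant (K.torusIncl k).left := K.isDominant k

/-- The inclusion of the points of the closures into the toric ind-variety. -/
def ι (k : ℕ) (p : Pt (K.W k)) : X.carrier := X.ind.ι (K.idx k) (p ≫ K.incl k)

theorem ι_injective (k : ℕ) : Function.Injective (K.ι k) := fun p q h => by
  have : Mono (K.incl k) := (Over.forget SpecC).mono_of_mono_map
    (inferInstanceAs (Mono (K.incl k).left))
  exact (cancel_mono (K.incl k)).mp (X.ind.ι_injective _ h)

theorem ι_torusIncl (k : ℕ) (p : Pt (F.tori.V k)) :
    K.ι k (p ≫ K.torusIncl k) = X.incl (F.tori.ι k p) := by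
  rw [ι, Category.assoc, K.ι_incl]

theorem hom_ext {Y : Over SpecC} [IsReduced Y.left] [LocallyOfFiniteType Y.hom] {k : ℕ}
    {f g : Y ⟶ K.W k} (h : ∀ p : Pt Y, K.ι k (p ≫ f) = K.ι k (p ≫ g)) : f = g :=
  hom_ext_of_pt fun p => K.ι_injective k (h p)

theorem exists_lift {D Y : Over SpecC} [LocallyOfFiniteType D.hom] [IsReduced Y.left] {i k : ℕ}
    (d : D ⟶ Y) [IsDominant d.left] (f : Y ⟶ X.ind.V i)
    (h : ∀ p : Pt D, ∃ q : Pt (K.W k), K.ι k q = X.ind.ι i (p ≫ d ≫ f)) :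
    ∃ g : Y ⟶ K.W k, ∀ p : Pt Y, K.ι k (p ≫ g) = X.ind.ι i (p ≫ f) := by
  obtain ⟨g, hg⟩ := X.ind.exists_lift d f (K.incl k) h
  exact ⟨g, fun p => by rw [ι, Category.assoc, hg]⟩

theorem exists_lift_of_pt {Y : Over SpecC} [LocallyOfFiniteType Y.hom] [IsReduced Y.left] {i k : ℕ}
    (f : Y ⟶ X.ind.V i) (h : ∀ p : Pt Y, ∃ q : Pt (K.W k), K.ι k q = X.ind.ι i (p ≫ f)) :
    ∃ g : Y ⟶ K.W k, ∀ p : Pt Y, K.ι k (p ≫ g) = X.ind.ι i (p ≫ f) := by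
  have : IsDominant (𝟙 Y : Y ⟶ Y).left := inferInstanceAs (IsDominant (𝟙 Y.left))
  exact K.exists_lift (𝟙 Y) f (by simpa using h)

/-- The torus at stage `k` lies in the next torus, and it is dense in its closure, so the closures
are nested. -/
theorem exists_φ (k : ℕ) : ∃ g : K.W k ⟶ K.W (k + 1), IsClosedImmersion g.left ∧
    ∀ p, K.ι (k + 1) (p ≫ g) = K.ι k p := by
  obtain ⟨g, hg⟩ := K.exists_lift (k := k + 1) (K.torusIncl k) (K.incl k) fun p =>
    ⟨p ≫ F.tori.φ k ≫ K.torusIncl (k + 1), by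
      rw [K.ι_incl, ← Category.assoc, K.ι_torusIncl, F.tori.ι_comp]⟩
  refine ⟨g, X.ind.isClosedImmersion_of_ι_comp (K.incl k) (K.incl (k + 1)) g fun p => ?_, hg⟩
  rw [← Category.assoc]
  exact hg p

/-- The closed immersions between the closures. -/
def φ (k : ℕ) : K.W k ⟶ K.W (k + 1) := (K.exists_φ k).choose

theorem isClosedImmersion_φ (k : ℕ) : IsClosedImmersion (K.φ k).left := (K.exists_φ k).choose_spec.1

theorem ι_comp (k : ℕ) (p : Pt (K.W k)) : K.ι (k + 1) (p ≫ K.φ k) = K.ι k p :=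
  (K.exists_φ k).choose_spec.2 p

open Limits in
-- This is where curve-connectedness enters.
theorem exists_ι_eq (x : X.carrier) : ∃ k p, K.ι k p = x := by
  obtain ⟨C, hC, i, g, p, q, hp, hq⟩ := X.curveConnected x (X.incl 1)
  have := hC.isVariety
  have := hC.irreducible
  obtain ⟨-, R, hR, hu⟩ := X.isOpenEmbedding
  obtain ⟨u, hu₁, hu₂, hu₃⟩ := hu i
  obtain ⟨k, h, hh⟩ := (F.equivalent.trans hR).isMorphism_symm i
  -- `D` is the open part of the curve lying over the ind-torus. It contains `q`, which maps to the
  -- identity, so it is dense in the irreducible curve.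
  let D : Over SpecC := Over.mk (pullback.fst g.left u.left ≫ C.hom)
  let d : D ⟶ C := Over.homMk (pullback.fst g.left u.left)
  let e : D ⟶ R.V i := Over.homMk (pullback.snd g.left u.left) (by
    rw [← Over.w u, ← pullback.condition_assoc, Over.w g]; rfl)
  have hde : d ≫ g = e ≫ u := by
    ext1
    exact pullback.condition
  have hd : IsOpenImmersion d.left := inferInstanceAs (IsOpenImmersion (pullback.fst g.left u.left))
  have : LocallyOfFiniteType D.hom :=
    inferInstanceAs (LocallyOfFiniteType (pullback.fst g.left u.left ≫ C.hom))
  have : IsDominant d.left := by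
    obtain ⟨q', hq'⟩ := hu₃ (q ≫ g) ⟨1, hq.symm⟩
    refine ⟨d.left.isOpenEmbedding.isOpen_range.dense ⟨q.point, ?_⟩⟩
    change q.point ∈ Set.range (pullback.fst g.left u.left)
    rw [Scheme.Pullback.range_fst]
    exact ⟨Pt.point q', by rw [← Pt.point_comp, hq', Pt.point_comp]⟩
  -- The torus part of the stratum lies in the single torus with index `k`, so `D` lands there and
  -- the whole curve lands in its closure.
  obtain ⟨g', hg'⟩ := K.exists_lift (k := k) d g fun p => ⟨p ≫ e ≫ h ≫ K.torusIncl k, by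
    rw [hde, ← Category.assoc p e u, hu₂, ← Category.assoc e, ← Category.assoc p, K.ι_torusIncl,
      ← Category.assoc, hh]
    rfl⟩
  exact ⟨k, p ≫ g', by rw [hg', hp]⟩

/-- The filtration of a toric ind-variety by the closures of the tori. -/
def filt : IndVariety X.carrier where
  V := K.W
  isVariety := K.isVariety
  φ := K.φ
  isClosedImmersion := K.isClosedImmersion_φ
  ι := K.ι
  ι_injective := K.ι_injective
  ι_comp := K.ι_comp
  exists_ι_eq := K.exists_ι_eq

theorem filt_equivalent : K.filt.Equivalent X.ind := by
  refine ⟨fun k => ⟨K.idx k, K.incl k, fun p => rfl⟩, fun i => ?_⟩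
  -- Closures of the sets of complex points of the stratum that lie in the `k`-th torus closure:
  -- they increase with `k` and together contain every complex point, so one of them is the whole
  -- stratum.
  let Z (k : ℕ) : Set (X.ind.V i).left :=
    closure {y | ∃ p : Pt (X.ind.V i), p.point = y ∧ ∃ q, K.ι k q = X.ind.ι i p}
  obtain ⟨k, hk⟩ := exists_eq_univ_of_monotone Z (fun k => isClosed_closure)
    (monotone_nat_of_le_succ fun k => closure_mono (by
      rintro y ⟨p, hp, q, hq⟩
      exact ⟨p, hp, q ≫ K.φ k, (K.ι_comp k q).trans hq⟩))
    fun p => by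
      obtain ⟨k, q, hq⟩ := K.exists_ι_eq (X.ind.ι i p)
      exact ⟨k, subset_closure ⟨p, rfl, q, hq⟩⟩
  obtain ⟨a, ha, haι⟩ := X.ind.exists_transition (le_max_left i (K.idx k))
  obtain ⟨b, hb, hbι⟩ := X.ind.exists_transition (le_max_right i (K.idx k))
  have : IsClosedImmersion (K.incl k ≫ b).left :=
    inferInstanceAs (IsClosedImmersion ((K.incl k).left ≫ b.left))
  obtain ⟨g, hg⟩ := exists_lift_of_range_subset a (K.incl k ≫ b) (by
    rw [← Set.univ_subset_iff, ← hk]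
    refine closure_minimal ?_
      ((K.incl k ≫ b).left.isClosedEmbedding.isClosed_range.preimage a.left.continuous)
    rintro _ ⟨p, rfl, q, hq⟩
    refine ⟨q.point, ?_⟩
    rw [← Pt.point_comp, ← Pt.point_comp]
    congr 1
    apply X.ind.ι_injective
    rw [haι, ← hq, ← Category.assoc, hbι]
    rfl)
  refine ⟨k, g, fun p => ?_⟩
  change X.ind.ι _ ((p ≫ g) ≫ K.incl k) = X.ind.ι i p
  rw [← hbι, ← haι, Category.assoc, Category.assoc, hg]

end TorusClosures

/-! ### The toric structure on the closures -/

/-- The constant morphism with a given value. -/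
def Pt.const {T : Over SpecC} (t : Pt T) (V : Over SpecC) : V ⟶ T :=
  Over.homMk (V.hom ≫ t.left) (by
    have := Over.w t
    rw [Category.assoc, this]
    exact Category.comp_id _)

theorem Pt.comp_const {T V : Over SpecC} (t : Pt T) (x : Pt V) : x ≫ t.const V = t := by
  ext1
  change x.left ≫ V.hom ≫ t.left = t.left
  rw [← Category.assoc, Over.w]
  exact Category.id_comp _

namespace TorusClosures

variable {X : ToricIndVariety.{u}} {F : TorusFiltration X.torusInd} (K : TorusClosures X F)

theorem exists_action (k : ℕ) : ∃ (j : ℕ) (a : F.tori.V k ⊗ K.W k ⟶ X.ind.V j),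
    ∀ (t : Pt (F.tori.V k)) (x : Pt (K.W k)),
      X.ind.ι j (lift t x ≫ a) = F.tori.ι k t • K.ι k x := by
  obtain ⟨m, hm⟩ := F.equivalent.isMorphism.exists_forall_ge k
  obtain ⟨f, hf⟩ := hm (max m (K.idx k)) (le_max_left _ _)
  obtain ⟨g, -, hg⟩ := X.ind.exists_transition (le_max_right m (K.idx k))
  obtain ⟨j, a, ha⟩ := X.regular_action (max m (K.idx k))
  refine ⟨j, (f ⊗ₘ (K.incl k ≫ g)) ≫ a, fun t x => ?_⟩
  rw [lift_map_assoc, ha, hf, ← Category.assoc, hg]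
  rfl

/-- Translation by `t` maps the torus to itself, and the torus is dense in its closure. -/
theorem exists_smul (k : ℕ) (t : Pt (F.tori.V k)) :
    ∃ g : K.W k ⟶ K.W k, ∀ x, K.ι k (x ≫ g) = F.tori.ι k t • K.ι k x := by
  obtain ⟨j, a, ha⟩ := K.exists_action k
  let _ := F.group k
  have e (x : Pt (K.W k)) : x ≫ lift (t.const _) (𝟙 _) ≫ a = lift t x ≫ a := by
    rw [← Category.assoc, comp_lift, t.comp_const, Category.comp_id]
  obtain ⟨g, hg⟩ := K.exists_lift (k := k) (K.torusIncl k) (lift (t.const _) (𝟙 _) ≫ a) fun p =>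
    ⟨(t * p) ≫ K.torusIncl k, by
      rw [← Category.assoc p, e, ha, K.ι_torusIncl, K.ι_torusIncl, F.ι_mul, X.smul_incl]⟩
  exact ⟨g, fun x => by rw [hg, e, ha]⟩

/-- The source is reduced, so factoring through the closed subvariety can be tested on complex
points, where `exists_smul` applies. -/
theorem exists_regular_action (k : ℕ) : ∃ a : F.tori.V k ⊗ K.W k ⟶ K.W k,
    ∀ (t : Pt (F.tori.V k)) (x : Pt (K.W k)),
      K.ι k (lift t x ≫ a) = F.tori.ι k t • K.ι k x := by
  obtain ⟨j, a, ha⟩ := K.exists_action k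
  let _ := F.group k
  have := (F.isAlgebraicTorus k).isReduced_tensorObj (K.W k)
  have := locallyOfFiniteType_tensorObj (F.tori.V k) (K.W k)
  have e (r : Pt (F.tori.V k ⊗ K.W k)) : r = lift (r ≫ fst _ _) (r ≫ snd _ _) := by simp
  obtain ⟨b, hb⟩ := K.exists_lift_of_pt (k := k) a fun r => by
    obtain ⟨g, hg⟩ := K.exists_smul k (r ≫ fst _ _)
    exact ⟨(r ≫ snd _ _) ≫ g, by rw [hg, ← ha, ← e]⟩
  exact ⟨b, fun t x => by rw [hb, ha]⟩

theorem ι_one (k : ℕ) : letI := F.group k; F.tori.ι k 1 = 1 := by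
  let _ := F.group k
  exact map_one (MonoidHom.mk' (F.tori.ι k) (F.ι_mul k))

/-- The action of the torus on its closure. -/
@[reducible] def action (k : ℕ) : letI := F.group k; MulAction (Pt (F.tori.V k)) (Pt (K.W k)) :=
  letI := F.group k
  { smul := fun t x => lift t x ≫ (K.exists_regular_action k).choose
    one_smul := fun x => K.ι_injective k (by
      refine ((K.exists_regular_action k).choose_spec 1 x).trans ?_
      rw [ι_one, one_smul])
    mul_smul := fun s t x => K.ι_injective k (by
      refine ((K.exists_regular_action k).choose_spec (s * t) x).trans ?_
      refine Eq.trans ?_ ((K.exists_regular_action k).choose_spec s _).symm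
      rw [F.ι_mul, mul_smul]
      exact congrArg _ ((K.exists_regular_action k).choose_spec t x).symm) }

/-- The closures of the tori are toric varieties. -/
def toric (k : ℕ) : ToricStructure (K.W k) (F.tori.V k) where
  isVariety := K.isVariety k
  irreducible := K.irreducible k
  group := F.group k
  isAlgebraicTorus := F.isAlgebraicTorus k
  incl := K.torusIncl k
  isOpenImmersion := K.isOpenImmersion k
  action := K.action k
  regular_action := ⟨(K.exists_regular_action k).choose, fun t x => rfl⟩
  smul_incl s t := K.ι_injective k (by
    refine ((K.exists_regular_action k).choose_spec s _).trans ?_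
    rw [K.ι_torusIncl, K.ι_torusIncl, X.smul_incl, F.ι_mul])

/-- The filtration by the closures of the tori is a toric filtration. -/
def toricFiltration : ToricFiltration X where
  filt := K.filt
  filt_equivalent := K.filt_equivalent
  tori := F.tori
  tori_equivalent := F.equivalent
  toric := K.toric
  toric_φ k := by
    refine ⟨F.tori.φ k, K.hom_ext fun p => ?_, fun s t => F.tori.ι_injective _ ?_⟩
    · change K.ι (k + 1) (p ≫ F.tori.φ k ≫ K.torusIncl (k + 1)) =
        K.ι (k + 1) (p ≫ K.torusIncl k ≫ K.φ k)
      rw [← Category.assoc, K.ι_torusIncl, F.tori.ι_comp, ← Category.assoc, K.ι_comp, K.ι_torusIncl]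
    · refine Eq.trans ?_ (F.ι_mul (k + 1) _ _).symm
      rw [F.tori.ι_comp, F.tori.ι_comp, F.tori.ι_comp]
      exact F.ι_mul k s t
  incl_ι k t := (K.ι_torusIncl k t).symm
  ι_mul := F.ι_mul

end TorusClosures

/-- Every toric ind-variety has a toric filtration. -/
theorem nonempty_toricFiltration (X : ToricIndVariety.{u}) : Nonempty (ToricFiltration X) := by
  obtain ⟨F⟩ := X.isIndTorus.nonempty_torusFiltration
  obtain ⟨K⟩ := nonempty_torusClosures X F
  exact ⟨K.toricFiltration⟩

end ToricInd

end

/-- A morphism `α : 𝒱 → 𝒱'` of toric ind-varieties is toric if and only if for all toric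
filtrations of `𝒱` and `𝒱'` and every `i` there is a `j` such that `α` restricts to a toric morphism
`V i ⟶ V' j` of toric varieties. -/
theorem mainTheorem8 (X : ToricInd.ToricIndVariety.{u}) (X' : ToricInd.ToricIndVariety.{v})
    (α : X.carrier → X'.carrier) (hα : X.ind.IsMorphism X'.ind α) :
    ToricInd.IsToricIndMorphism X X' α ↔
      ∀ (F : ToricInd.ToricFiltration X) (F' : ToricInd.ToricFiltration X') (i : ℕ),
        ∃ (j : ℕ) (g : F.filt.V i ⟶ F'.filt.V j),
          (∀ p : ToricInd.Pt (F.filt.V i), F'.filt.ι j (p ≫ g) = α (F.filt.ι i p)) ∧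
            ToricInd.IsToricMorphism (F.toric i) (F'.toric j) g := by
  refine ⟨fun h F F' i => h.exists_isToricMorphism hα F F' i, fun h => ?_⟩
  -- The hypothesis quantifies over all toric filtrations, so it says something only once a pair is
  -- known to exist.
  obtain ⟨F⟩ := ToricInd.nonempty_toricFiltration X
  obtain ⟨F'⟩ := ToricInd.nonempty_toricFiltration X'
  exact ToricInd.isToricIndMorphism_of_forall F F' (h F F')
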